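/- For a square complex matrix $A$ and real $p\ge 1$ let $\|A\|_p=(\mathrm{Tr}\,|A|^p)^{1/p}$ be the Schatten norm; for positive semidefinite $Q$ let $S(Q)=-\mathrm{Tr}\,Q\log Q$ be the von Neumann entropy (with $0\log 0=0$). Let $\Phi: M_m(\mathbb{C})\to M_n(\mathbb{C})$ be a linear map that is trace preserving and entanglement breaking, i.e. for every $k$ and every density matrix $\rho\in M_k\otimes M_m$ the matrix $(\mathcal{I}\otimes\Phi)(\rho)$ is separable (a finite sum of tensor products of positive semidefinite matrices). Define $$\omega_p(\Phi)=\sup_{\psi\in\mathbb{C}^m\otimes\mathbb{C}^m,\ \|\psi\|=1}\frac{\|(\mathcal{I}\otimes\Phi)(|\psi\rangle\langle\psi|)\|_p}{\|\mathrm{Tr}_2\,|\psi\rangle\langle\psi|\,\|_p},$$ $$S_{\mathrm{CB,min}}(\Phi)=\inf_{\psi\in\mathbb{C}^m\otimes\mathbb{C}^m,\ \|\psi\|=1}\Big(S\big[(\mathcal{I}\otimes\Phi)(|\psi\rangle\langle\psi|)\big]-S\big[\mathrm{Tr}_2\,|\psi\rangle\langle\psi|\,\big]\Big).$$ Then: (1)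 for every real $p\ge 1$ the supremum $\omega_p(\Phi)$ is finite and $\omega_p(\Phi)\le 1$; (2) the infimum $S_{\mathrm{CB,min}}(\Phi)$ is finite and $S_{\mathrm{CB,min}}(\Phi)\ge 0$; (3) for every real $p\ge 1$, every $k$ and every positive semidefinite $Q\in M_k\otimes M_m$, $\ \|(\mathcal{I}\otimes\Phi)(Q)\|_p\le\|\mathrm{Tr}_2\,Q\|_p$. -/

import Mathlib

open scoped ComplexOrder

namespace CBEntropy

open scoped Matrix Kronecker

/-- The Schatten norm `‖A‖_p = (Tr |A|^p)^(1/p)`, with `|A|^p = f (A* A)` for `f x = (√x)^p`, where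
`f` acts on the Hermitian matrix `A* A` through its spectral decomposition. -/
noncomputable def schattenNorm {ι : Type*} [Fintype ι] [DecidableEq ι] (p : ℝ)
    (A : Matrix ι ι ℂ) : ℝ :=
  (Matrix.trace (cfc (fun x : ℝ => Real.sqrt x ^ p) (Aᴴ * A))).re ^ (1 / p)

/-- The von Neumann entropy `S(Q) = - Tr Q log Q` (with `0 log 0 = 0`): the trace of `f Q` for
`f x = - x log x`, where `f` acts through the spectral decomposition of `Q`. -/
noncomputable def entropy {ι : Type*} [Fintype ι] [DecidableEq ι] (Q : Matrix ι ι ℂ) : ℝ :=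
  (Matrix.trace (cfc Real.negMulLog Q)).re

/-- The partial trace over the second tensor factor. -/
def partialTrace₂ {κ ι : Type*} [Fintype ι] (X : Matrix (κ × ι) (κ × ι) ℂ) : Matrix κ κ ℂ :=
  Matrix.of fun i j => ∑ s, X (i, s) (j, s)

/-- The map `I ⊗ Φ`: it applies `Φ` to each block `X_{ij}` of `X = ∑ E_{ij} ⊗ X_{ij}`. -/
def idTensor {κ ι ι' : Type*} (Φ : Matrix ι ι ℂ →ₗ[ℂ] Matrix ι' ι' ℂ)
    (X : Matrix (κ × ι) (κ × ι) ℂ) : Matrix (κ × ι') (κ × ι') ℂ :=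
  Matrix.of fun a b => Φ (Matrix.of fun s t => X (a.1, s) (b.1, t)) a.2 b.2

/-- On product matrices, `(I ⊗ Φ)(A ⊗ B) = A ⊗ Φ(B)`. -/
theorem idTensor_kronecker {κ ι ι' : Type*} (Φ : Matrix ι ι ℂ →ₗ[ℂ] Matrix ι' ι' ℂ)
    (A : Matrix κ κ ℂ) (B : Matrix ι ι ℂ) : idTensor Φ (A ⊗ₖ B) = A ⊗ₖ Φ B := by
  ext a b
  have h : (Matrix.of fun s t => (A ⊗ₖ B) (a.1, s) (b.1, t)) = A a.1 b.1 • B := rfl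
  rw [idTensor, Matrix.of_apply, h, map_smul]
  rfl

/-- The rank-one matrix `|ψ⟩⟨ψ|`. -/
def ketBra {ι : Type*} (ψ : EuclideanSpace ℂ ι) : Matrix ι ι ℂ :=
  Matrix.of fun a b => ψ a * star (ψ b)

/-- Density matrices: positive semidefinite of trace one. -/
def IsDensity {ι : Type*} [Fintype ι] (ρ : Matrix ι ι ℂ) : Prop :=
  ρ.PosSemidef ∧ ρ.trace = 1

/-- A (not necessarily normalized) bipartite matrix is separable if it is a finite sum of tensor
products of positive semidefinite matrices; for a density matrix this means that it is a convex
combination of products of density matrices. -/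
def IsSeparable {κ ι : Type*} (X : Matrix (κ × ι) (κ × ι) ℂ) : Prop :=
  ∃ (r : ℕ) (A : Fin r → Matrix κ κ ℂ) (B : Fin r → Matrix ι ι ℂ),
    (∀ j, (A j).PosSemidef) ∧ (∀ j, (B j).PosSemidef) ∧ X = ∑ j, A j ⊗ₖ B j

/-- `Φ` is entanglement breaking if `(I_k ⊗ Φ)(ρ)` is separable for every ancilla dimension `k` and
every input state `ρ`. (Such a map is automatically completely positive.) -/
def IsEntanglementBreaking {m n : ℕ}
    (Φ : Matrix (Fin m) (Fin m) ℂ →ₗ[ℂ] Matrix (Fin n) (Fin n) ℂ) : Prop :=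
  ∀ (k : ℕ) (ρ : Matrix (Fin k × Fin m) (Fin k × Fin m) ℂ),
    IsDensity ρ → IsSeparable (idTensor Φ ρ)

def IsTracePreserving {m n : ℕ}
    (Φ : Matrix (Fin m) (Fin m) ℂ →ₗ[ℂ] Matrix (Fin n) (Fin n) ℂ) : Prop :=
  ∀ X, (Φ X).trace = X.trace

/-- The ratios `‖(I ⊗ Φ)(|ψ⟩⟨ψ|)‖_p / ‖Tr₂ |ψ⟩⟨ψ|‖_p`, for unit vectors `ψ ∈ ℂ^m ⊗ ℂ^m`. -/
def omegaRatios {m n : ℕ} (p : ℝ)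
    (Φ : Matrix (Fin m) (Fin m) ℂ →ₗ[ℂ] Matrix (Fin n) (Fin n) ℂ) : Set ℝ :=
  {x | ∃ ψ : EuclideanSpace ℂ (Fin m × Fin m), ‖ψ‖ = 1 ∧
    x = schattenNorm p (idTensor Φ (ketBra ψ)) / schattenNorm p (partialTrace₂ (ketBra ψ))}

/-- `ω_p(Φ)`, the supremum of these ratios. -/
noncomputable def omega {m n : ℕ} (p : ℝ)
    (Φ : Matrix (Fin m) (Fin m) ℂ →ₗ[ℂ] Matrix (Fin n) (Fin n) ℂ) : ℝ :=
  sSup (omegaRatios p Φ)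

/-- The differences `S((I ⊗ Φ)(|ψ⟩⟨ψ|)) - S(Tr₂ |ψ⟩⟨ψ|)`, for unit vectors `ψ ∈ ℂ^m ⊗ ℂ^m`. -/
def condEntropies {m n : ℕ}
    (Φ : Matrix (Fin m) (Fin m) ℂ →ₗ[ℂ] Matrix (Fin n) (Fin n) ℂ) : Set ℝ :=
  {x | ∃ ψ : EuclideanSpace ℂ (Fin m × Fin m), ‖ψ‖ = 1 ∧
    x = entropy (idTensor Φ (ketBra ψ)) - entropy (partialTrace₂ (ketBra ψ))}

/-- The CB minimal entropy `S_{CB,min}(Φ)`, the infimum of these differences. -/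
noncomputable def cbMinEntropy {m n : ℕ}
    (Φ : Matrix (Fin m) (Fin m) ℂ →ₗ[ℂ] Matrix (Fin n) (Fin n) ℂ) : ℝ :=
  sInf (condEntropies Φ)

end CBEntropy

namespace CBEntropy

open scoped Matrix Kronecker

/-! Trace preservation gives `Tr₂ (I ⊗ Φ)(Q) = Tr₂ Q`, so everything compares a separable `X` with
`R = Tr₂ X`. Write `X = ∑ |x_j ⊗ y_j⟩⟨x_j ⊗ y_j|` with unit `y_j`; then `R = ∑ |x_j⟩⟨x_j|`. Polar
decompositions of both factors yield a doubly substochastic matrix taking the spectrum of `R` to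
that of `X` (`exists_doublySubstochastic`). As the traces agree, convex `f` with `f 0 = 0` satisfies
`Tr f(X) ≤ Tr f(R)` (`IsSeparable.sum_map_eigenvalues_le`). The choices `x ^ p` and `x log x` give
the norm and entropy bounds. -/

/-! ### Spectral formulas for traces. -/

theorem trace_cfc_re {ι : Type*} [Fintype ι] [DecidableEq ι] {A : Matrix ι ι ℂ}
    (hA : A.IsHermitian) (f : ℝ → ℝ) :
    (Matrix.trace (cfc f A)).re = ∑ i, f (hA.eigenvalues i) := by
  rw [hA.cfc_eq, Matrix.IsHermitian.cfc, Unitary.conjStarAlgAut_apply, Matrix.trace_mul_cycle,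
    Unitary.coe_star_mul_self, one_mul, Matrix.trace_diagonal, Complex.re_sum]
  simp

theorem trace_cfc_sqrt_rpow_re {ι : Type*} [Fintype ι] [DecidableEq ι] {A : Matrix ι ι ℂ}
    (hA : A.PosSemidef) (p : ℝ) :
    (Matrix.trace (cfc (fun x : ℝ => Real.sqrt x ^ p) (Aᴴ * A))).re =
      ∑ i, hA.isHermitian.eigenvalues i ^ p := by
  have h : cfc (fun x : ℝ => Real.sqrt x ^ p) (Aᴴ * A) =
      cfc (fun x : ℝ => Real.sqrt (x ^ 2) ^ p) A := by
    have hs : IsSelfAdjoint A := hA.isHermitian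
    -- Any function is continuous on a finite spectrum, so `p` is unrestricted.
    have hfin : (spectrum ℝ A).Finite := Matrix.finite_real_spectrum
    rw [hA.isHermitian.eq, ← pow_two,
      cfc_comp_pow (fun x : ℝ => Real.sqrt x ^ p) 2 A ((hfin.image _).continuousOn _) hs]
  rw [h, trace_cfc_re hA.isHermitian]
  exact Finset.sum_congr rfl fun i _ => by rw [Real.sqrt_sq (hA.eigenvalues_nonneg i)]

theorem trace_eq_re_sum_eigenvalues {ι : Type*} [Fintype ι] [DecidableEq ι] {A : Matrix ι ι ℂ}
    (hA : A.IsHermitian) : A.trace.re = ∑ i, hA.eigenvalues i := by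
  rw [hA.trace_eq_sum_eigenvalues, Complex.re_sum]; simp

theorem schattenNorm_nonneg {ι : Type*} [Fintype ι] [DecidableEq ι] {A : Matrix ι ι ℂ}
    (hA : A.PosSemidef) (p : ℝ) : 0 ≤ schattenNorm p A := by
  rw [schattenNorm, trace_cfc_sqrt_rpow_re hA]
  exact Real.rpow_nonneg
    (Finset.sum_nonneg fun i _ => Real.rpow_nonneg (hA.eigenvalues_nonneg i) _) _

/-! ### Partial isometries and polar decomposition. -/

theorem star_dotProduct_self {L : Type*} [Fintype L] (w : L → ℂ) :
    star w ⬝ᵥ w = ((∑ l, ‖w l‖ ^ 2 : ℝ) : ℂ) := by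
  simp [dotProduct, Complex.conj_mul']

/-- A partial isometry `U` satisfies the Bessel inequality. -/
theorem sum_norm_sq_mulVec_le {K J : Type*} [Fintype K] [Fintype J] [DecidableEq J]
    {U : Matrix K J ℂ} (hU : U * Uᴴ * U = U) (z : J → ℂ) :
    ∑ k, ‖∑ j, U k j * z j‖ ^ 2 ≤ ∑ j, ‖z j‖ ^ 2 := by
  -- `1 - Uᴴ * U` is an orthogonal projection, hence positive.
  have h1 : (1 - Uᴴ * U)ᴴ * (1 - Uᴴ * U) = 1 - Uᴴ * U := by
    have : Uᴴ * U * (Uᴴ * U) = Uᴴ * U := by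
      rw [Matrix.mul_assoc, ← Matrix.mul_assoc U, hU]
    simp [Matrix.sub_mul, Matrix.mul_sub, this]
  have h2 : (1 - Uᴴ * U).PosSemidef := h1 ▸ Matrix.posSemidef_conjTranspose_mul_self _
  have h3 := h2.dotProduct_mulVec_nonneg z
  rw [Matrix.sub_mulVec, Matrix.one_mulVec, dotProduct_sub, ← Matrix.mulVec_mulVec,
    Matrix.dotProduct_mulVec, Matrix.vecMul_conjTranspose, star_star, star_dotProduct_self,
    star_dotProduct_self, ← Complex.ofReal_sub,
    Complex.zero_le_real, sub_nonneg] at h3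
  exact h3

theorem sum_norm_sq_conj_mulVec_le {K J : Type*} [Fintype K] [Fintype J] [DecidableEq J]
    {U : Matrix K J ℂ} (hU : U * Uᴴ * U = U) (z : J → ℂ) :
    ∑ k, ‖∑ j, star (U k j) * z j‖ ^ 2 ≤ ∑ j, ‖z j‖ ^ 2 := by
  have h := sum_norm_sq_mulVec_le hU (star z)
  simp only [Pi.star_apply, norm_star] at h
  refine le_trans (le_of_eq (Finset.sum_congr rfl fun k _ => ?_)) h
  rw [← norm_star (∑ j, star (U k j) * z j), star_sum]
  simp [mul_comm]

theorem apply_self_of_mul_conjTranspose_eq_diagonal {K J : Type*} [Fintype J] [DecidableEq K]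
    {P : Matrix K J ℂ} {r : K → ℝ} (h : P * Pᴴ = Matrix.diagonal fun k => (r k : ℂ)) (k : K) :
    ∑ j, ‖P k j‖ ^ 2 = r k := by
  have := congrFun (congrFun h k) k
  simp only [Matrix.mul_apply, Matrix.conjTranspose_apply, Matrix.diagonal_apply_eq,
    RCLike.star_def, Complex.mul_conj'] at this
  exact_mod_cast this

/-- Polar decomposition of a matrix whose rows are orthogonal. -/
theorem exists_partialIsometry {K J : Type*} [Fintype K] [Fintype J] [DecidableEq K]
    [DecidableEq J] {P : Matrix K J ℂ} {r : K → ℝ}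
    (h : P * Pᴴ = Matrix.diagonal fun k => (r k : ℂ)) :
    ∃ U : Matrix K J ℂ, (∀ k j, P k j = (√(r k) : ℝ) * U k j) ∧ U * Uᴴ * U = U ∧
      (∀ k, ∑ j, ‖U k j‖ ^ 2 ≤ 1) ∧ ∀ k, ∑ l, ‖∑ j, star (U k j) * P l j‖ ^ 2 = r k := by
  have hr := apply_self_of_mul_conjTranspose_eq_diagonal h
  have hr0 : ∀ k, 0 ≤ r k := fun k => hr k ▸ Finset.sum_nonneg fun j _ => sq_nonneg _
  have hP0 : ∀ k, r k = 0 → ∀ j, P k j = 0 := by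
    intro k hk j
    have := (Finset.sum_eq_zero_iff_of_nonneg fun j _ => sq_nonneg ‖P k j‖).1 ((hr k).trans hk) j
      (Finset.mem_univ j)
    simpa using this
  -- Since `0⁻¹ = 0`, rows with `r k = 0` become zero rows of `U`; hence a partial isometry with row
  -- norms at most one.
  have hPU : ∀ k j, P k j = (√(r k) : ℝ) * (((√(r k) : ℝ) : ℂ)⁻¹ * P k j) := by
    intro k j
    rcases eq_or_ne (r k) 0 with hk | hk
    · simp [hP0 k hk j]
    · have : ((√(r k) : ℝ) : ℂ) ≠ 0 := by
        exact_mod_cast (Real.sqrt_ne_zero (hr0 k)).2 hk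
      rw [mul_inv_cancel_left₀ this]
  have hUP : ∀ l k, ∑ j, star (((√(r k) : ℝ) : ℂ)⁻¹ * P k j) * P l j =
      if l = k then ((√(r k) : ℝ) : ℂ) else 0 := by
    intro l k
    have h1 := congrFun (congrFun h l) k
    simp only [Matrix.mul_apply, Matrix.conjTranspose_apply, Matrix.diagonal_apply] at h1
    have h2 : ∑ j, star (((√(r k) : ℝ) : ℂ)⁻¹ * P k j) * P l j =
        ((√(r k) : ℝ) : ℂ)⁻¹ * ∑ j, P l j * star (P k j) := by
      rw [Finset.mul_sum]
      refine Finset.sum_congr rfl fun j _ => ?_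
      simp only [star_mul', RCLike.star_def, map_inv₀, Complex.conj_ofReal]
      ring
    rw [h2, h1]
    split_ifs with hlk
    · subst hlk
      norm_cast
      rw [inv_mul_eq_div, Real.div_sqrt]
    · simp
  refine ⟨Matrix.of fun k j => ((√(r k) : ℝ) : ℂ)⁻¹ * P k j, hPU, ?_, ?_, ?_⟩
  · have hd : (Matrix.of fun k j => ((√(r k) : ℝ) : ℂ)⁻¹ * P k j) *
        (Matrix.of fun k j => ((√(r k) : ℝ) : ℂ)⁻¹ * P k j)ᴴ =
        Matrix.diagonal fun k => ((√(r k) : ℝ) : ℂ)⁻¹ * (√(r k) : ℝ) := by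
      ext l k
      have h1 : ((Matrix.of fun k j => ((√(r k) : ℝ) : ℂ)⁻¹ * P k j) *
        (Matrix.of fun k j => ((√(r k) : ℝ) : ℂ)⁻¹ * P k j)ᴴ) l k = ((√(r l) : ℝ) : ℂ)⁻¹ *
          ∑ j, star (((√(r k) : ℝ) : ℂ)⁻¹ * P k j) * P l j := by
        rw [Matrix.mul_apply, Finset.mul_sum]
        refine Finset.sum_congr rfl fun j _ => ?_
        simp only [Matrix.conjTranspose_apply, Matrix.of_apply]
        ring
      rw [h1, hUP, Matrix.diagonal_apply]
      split_ifs with hlk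
      · rw [hlk]
      · simp
    rw [hd]
    ext k j
    rw [Matrix.diagonal_mul, Matrix.of_apply, mul_assoc, ← hPU k j]
  · intro k
    simp only [Matrix.of_apply, norm_mul, mul_pow, ← Finset.mul_sum, hr, norm_inv,
      Complex.norm_real, Real.norm_eq_abs, sq_abs, inv_pow, Real.sq_sqrt (hr0 k)]
    exact inv_mul_le_one
  · intro k
    simp only [Matrix.of_apply, hUP]
    rw [Finset.sum_eq_single k (fun l _ hl => by simp [hl]) (by simp)]
    simp [Real.sq_sqrt (hr0 k)]

/-- If `A = M Mᴴ`, then in an eigenbasis of `A` the matrix `M` has orthogonal rows. -/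
theorem exists_diagonalizing_factor {K J : Type*} [Fintype K] [Fintype J] [DecidableEq K]
    {A : Matrix K K ℂ} (hA : A.IsHermitian) {M : Matrix K J ℂ} (h : A = M * Mᴴ) :
    ∃ P : Matrix K J ℂ, P * Pᴴ = Matrix.diagonal (fun k => (hA.eigenvalues k : ℂ)) ∧
      Pᴴ * P = Mᴴ * M := by
  have h1 := hA.conjStarAlgAut_star_eigenvectorUnitary
  rw [Unitary.conjStarAlgAut_star_apply] at h1
  refine ⟨star (hA.eigenvectorUnitary : Matrix K K ℂ) * M, ?_, ?_⟩
  · rw [Matrix.conjTranspose_mul, ← Matrix.star_eq_conjTranspose (star _), star_star,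
      Matrix.mul_assoc, ← Matrix.mul_assoc M, ← h, ← Matrix.mul_assoc]
    exact h1
  · rw [Matrix.conjTranspose_mul, ← Matrix.star_eq_conjTranspose (star _), star_star,
      Matrix.mul_assoc, ← Matrix.mul_assoc _ (star _), Unitary.mul_star_self_of_mem (SetLike.coe_mem _),
      Matrix.one_mul]

/-! ### Product vectors and the Nielsen–Kempe matrix. -/

/-- The matrix whose columns are the product vectors `x_j ⊗ y_j`. -/
def productColumns {κ ι J : Type*} (M : Matrix κ J ℂ) (y : J → ι → ℂ) : Matrix (κ × ι) J ℂ :=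
  Matrix.of fun a j => M a.1 j * y j a.2

theorem productColumns_gram_apply {κ ι J : Type*} [Fintype κ] [Fintype ι] (M : Matrix κ J ℂ)
    (y : J → ι → ℂ) (i j : J) : ((productColumns M y)ᴴ * productColumns M y) i j =
      (Mᴴ * M) i j * ∑ s, star (y i s) * y j s := by
  simp only [Matrix.mul_apply, Matrix.conjTranspose_apply, productColumns, Matrix.of_apply,
    Fintype.sum_prod_type, Finset.sum_mul_sum, star_mul']
  exact Finset.sum_congr rfl fun a _ => Finset.sum_congr rfl fun s _ => by ring

/-- The Gram matrix of product vectors is the entrywise product of the Gram matrices of the factors,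
so `M` enters only through `Mᴴ * M`. -/
theorem productColumns_gram {κ κ' ι J : Type*} [Fintype κ] [Fintype κ'] [Fintype ι]
    {M : Matrix κ J ℂ} {N : Matrix κ' J ℂ} (h : Nᴴ * N = Mᴴ * M) (y : J → ι → ℂ) :
    (productColumns N y)ᴴ * productColumns N y = (productColumns M y)ᴴ * productColumns M y := by
  ext i j
  rw [productColumns_gram_apply, productColumns_gram_apply, h]

theorem sum_norm_sq_congr_of_gram {K K' J : Type*} [Fintype K] [Fintype K'] [Fintype J]
    {P : Matrix K J ℂ} {Q : Matrix K' J ℂ} (h : Pᴴ * P = Qᴴ * Q) (u : J → ℂ) :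
    ∑ l, ‖∑ j, u j * P l j‖ ^ 2 = ∑ l, ‖∑ j, u j * Q l j‖ ^ 2 := by
  have key : star u ⬝ᵥ ((Pᴴ * P) *ᵥ u) = star u ⬝ᵥ ((Qᴴ * Q) *ᵥ u) := by rw [h]
  simp only [← Matrix.mulVec_mulVec, Matrix.dotProduct_mulVec _ _ᴴ, Matrix.vecMul_conjTranspose,
    star_star, star_dotProduct_self, Complex.ofReal_inj] at key
  simpa only [Matrix.mulVec, dotProduct, mul_comm] using key

/-- **Nielsen–Kempe**: the eigenvalues of a separable matrix are the image of those of its reduced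
matrix under a doubly substochastic matrix. -/
theorem exists_doublySubstochastic {κ ι J : Type*} [Fintype κ] [Fintype ι] [Fintype J]
    [DecidableEq κ] [DecidableEq ι] (M : Matrix κ J ℂ) (y : J → ι → ℂ)
    (hy : ∀ j, ∑ s, ‖y j s‖ ^ 2 ≤ 1) {X : Matrix (κ × ι) (κ × ι) ℂ} {R : Matrix κ κ ℂ}
    (hX : X.IsHermitian) (hR : R.IsHermitian)
    (hXM : X = productColumns M y * (productColumns M y)ᴴ) (hRM : R = M * Mᴴ) :
    ∃ D : κ × ι → κ → ℝ, (∀ k i, 0 ≤ D k i) ∧ (∀ k, ∑ i, D k i ≤ 1) ∧ (∀ i, ∑ k, D k i ≤ 1) ∧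
      ∀ k, hX.eigenvalues k = ∑ i, D k i * hR.eigenvalues i := by
  classical
  obtain ⟨P, hP, hPg⟩ := exists_diagonalizing_factor hX hXM
  obtain ⟨N, hN, hNg⟩ := exists_diagonalizing_factor hR hRM
  obtain ⟨U, -, hU, hU1, hUP⟩ := exists_partialIsometry hP
  obtain ⟨V, hV, hVV, hV1, -⟩ := exists_partialIsometry hN
  have hR0 : ∀ i, 0 ≤ hR.eigenvalues i := fun i =>
    apply_self_of_mul_conjTranspose_eq_diagonal hN i ▸ Finset.sum_nonneg fun j _ => sq_nonneg _
  -- Column `j` of `V`, tensored with `y j`, is contracted against row `k` of `U`. Bessel for `V`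
  -- bounds the row sums, Bessel for `U` the column sums.
  refine ⟨fun k i => ∑ s, ‖∑ j, star (U k j) * (V i j * y j s)‖ ^ 2,
    fun k i => Finset.sum_nonneg fun s _ => sq_nonneg _, fun k => ?_, fun i => ?_, fun k => ?_⟩
  · rw [Finset.sum_comm]
    calc ∑ s, ∑ i, ‖∑ j, star (U k j) * (V i j * y j s)‖ ^ 2
        = ∑ s, ∑ i, ‖∑ j, V i j * (star (U k j) * y j s)‖ ^ 2 := by
          simp only [mul_left_comm]
      _ ≤ ∑ s, ∑ j, ‖star (U k j) * y j s‖ ^ 2 :=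
          Finset.sum_le_sum fun s _ => sum_norm_sq_mulVec_le hVV _
      _ = ∑ j, ‖U k j‖ ^ 2 * ∑ s, ‖y j s‖ ^ 2 := by
          rw [Finset.sum_comm]
          simp only [norm_mul, norm_star, mul_pow, Finset.mul_sum]
      _ ≤ ∑ j, ‖U k j‖ ^ 2 :=
          Finset.sum_le_sum fun j _ => mul_le_of_le_one_right (sq_nonneg _) (hy j)
      _ ≤ 1 := hU1 k
  · rw [Finset.sum_comm]
    calc ∑ s, ∑ k, ‖∑ j, star (U k j) * (V i j * y j s)‖ ^ 2
        ≤ ∑ s, ∑ j, ‖V i j * y j s‖ ^ 2 :=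
          Finset.sum_le_sum fun s _ => sum_norm_sq_conj_mulVec_le hU _
      _ = ∑ j, ‖V i j‖ ^ 2 * ∑ s, ‖y j s‖ ^ 2 := by
          rw [Finset.sum_comm]
          simp only [norm_mul, mul_pow, Finset.mul_sum]
      _ ≤ ∑ j, ‖V i j‖ ^ 2 :=
          Finset.sum_le_sum fun j _ => mul_le_of_le_one_right (sq_nonneg _) (hy j)
      _ ≤ 1 := hV1 i
  -- `P` and `productColumns N y` share a Gram matrix, so one may replace the other inside the norm.
  · rw [← hUP k, sum_norm_sq_congr_of_gram (hPg.trans (productColumns_gram hNg y).symm),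
      Fintype.sum_prod_type]
    refine Finset.sum_congr rfl fun i _ => ?_
    rw [Finset.sum_mul]
    refine Finset.sum_congr rfl fun s _ => ?_
    have h1 : ∑ j, star (U k j) * productColumns N y (i, s) j =
        (√(hR.eigenvalues i) : ℝ) * ∑ j, star (U k j) * (V i j * y j s) := by
      rw [Finset.mul_sum]
      refine Finset.sum_congr rfl fun j _ => ?_
      simp only [productColumns, Matrix.of_apply, hV i j]
      ring
    rw [h1, norm_mul, mul_pow, Complex.norm_real, Real.norm_eq_abs, sq_abs,
      Real.sq_sqrt (hR0 i), mul_comm]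

/-! ### Convexity and substochastic matrices. -/

/-- A convex function vanishing at `0` contracts row-wise under a substochastic matrix. -/
theorem map_sum_le_of_substochastic {I : Type*} [Fintype I] {f : ℝ → ℝ}
    (hf : ConvexOn ℝ (Set.Ici 0) f) (hf0 : f 0 = 0) {d a : I → ℝ} (hd : ∀ i, 0 ≤ d i)
    (hd1 : ∑ i, d i ≤ 1) (ha : ∀ i, 0 ≤ a i) : f (∑ i, d i * a i) ≤ ∑ i, d i * f (a i) := by
  -- Jensen, with the missing weight placed at the point `0` (index `none`).
  have h := hf.map_sum_le (t := Finset.univ) (w := fun o : Option I => o.elim (1 - ∑ i, d i) d)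
    (p := fun o => o.elim 0 a) (by rintro (_ | i) -; exacts [sub_nonneg.2 hd1, hd i])
    (by simp [Fintype.sum_option])
    (by rintro (_ | i) -; exacts [Set.mem_Ici.2 le_rfl, Set.mem_Ici.2 (ha i)])
  simpa [Fintype.sum_option, hf0] using h

/-- Equal sums force column sum one wherever `a i ≠ 0`. This is needed because `f`, such as `x log
x`, may be negative. -/
theorem sum_map_le_of_doublySubstochastic {K I : Type*} [Fintype K] [Fintype I] {f : ℝ → ℝ}
    (hf : ConvexOn ℝ (Set.Ici 0) f) (hf0 : f 0 = 0) {D : K → I → ℝ} (hD : ∀ k i, 0 ≤ D k i)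
    (hrow : ∀ k, ∑ i, D k i ≤ 1) (hcol : ∀ i, ∑ k, D k i ≤ 1) {r : K → ℝ} {a : I → ℝ}
    (ha : ∀ i, 0 ≤ a i) (hr : ∀ k, r k = ∑ i, D k i * a i) (hsum : ∑ k, r k = ∑ i, a i) :
    ∑ k, f (r k) ≤ ∑ i, f (a i) := by
  have h1 : ∑ i, (1 - ∑ k, D k i) * a i = 0 := by
    simp only [sub_mul, one_mul, Finset.sum_sub_distrib, Finset.sum_mul]
    rw [Finset.sum_comm, ← hsum, Finset.sum_congr rfl fun k _ => hr k, sub_self]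
  have h2 : ∀ i, (∑ k, D k i) * f (a i) = f (a i) := by
    intro i
    have := (Finset.sum_eq_zero_iff_of_nonneg fun i _ =>
      mul_nonneg (sub_nonneg.2 (hcol i)) (ha i)).1 h1 i (Finset.mem_univ i)
    rcases mul_eq_zero.1 this with h | h
    · rw [← sub_eq_zero.1 h, one_mul]
    · rw [h, hf0, mul_zero]
  calc ∑ k, f (r k) ≤ ∑ k, ∑ i, D k i * f (a i) := Finset.sum_le_sum fun k _ => by
        rw [hr k]; exact map_sum_le_of_substochastic hf hf0 (hD k) (hrow k) ha
    _ = ∑ i, f (a i) := by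
        rw [Finset.sum_comm]
        exact Finset.sum_congr rfl fun i _ => by rw [← Finset.sum_mul, h2]

/-! ### Separable matrices. -/

/-- The norm of `y` moves into `x`. The middle condition says that `y'` is a unit vector or `x' =
0`, which covers `y = 0`. -/
theorem exists_normalized_product {κ ι : Type*} [Fintype ι] (x : κ → ℂ) (y : ι → ℂ) :
    ∃ (x' : κ → ℂ) (y' : ι → ℂ), (∑ s, ‖y' s‖ ^ 2 ≤ 1) ∧
      (∀ a, x' a * ((∑ s, ‖y' s‖ ^ 2 : ℝ) : ℂ) = x' a) ∧ ∀ a s, x' a * y' s = x a * y s := by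
  set c : ℝ := √(∑ s, ‖y s‖ ^ 2) with hc
  have hs : 0 ≤ ∑ s, ‖y s‖ ^ 2 := Finset.sum_nonneg fun s _ => sq_nonneg _
  have hn : ∑ s, ‖(c : ℂ)⁻¹ * y s‖ ^ 2 = (∑ s, ‖y s‖ ^ 2)⁻¹ * ∑ s, ‖y s‖ ^ 2 := by
    simp only [norm_mul, norm_inv, Complex.norm_real, Real.norm_eq_abs, mul_pow, inv_pow, sq_abs,
      ← Finset.mul_sum, hc, Real.sq_sqrt hs]
  refine ⟨fun a => c * x a, fun s => (c : ℂ)⁻¹ * y s, hn ▸ inv_mul_le_one, fun a => ?_,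
    fun a s => ?_⟩
  · rw [hn]
    rcases eq_or_ne c 0 with h | h
    · simp [h]
    · rw [inv_mul_cancel₀ fun h0 => h (by rw [hc, h0, Real.sqrt_zero]), Complex.ofReal_one, mul_one]
  · rcases eq_or_ne c 0 with h | h
    · have h0 : y s = 0 := by
        simpa using (Finset.sum_eq_zero_iff_of_nonneg fun s _ => sq_nonneg ‖y s‖).1
          ((Real.sqrt_eq_zero hs).1 h) s (Finset.mem_univ s)
      simp [h0]
    · have : (c : ℂ) ≠ 0 := by exact_mod_cast h
      field_simp

/-- Each factor splits into rank-one terms; normalizing the second vectors makes their squared norms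
disappear from the partial trace. -/
theorem IsSeparable.exists_productColumns {κ ι : Type*} [Finite κ] [Fintype ι]
    {X : Matrix (κ × ι) (κ × ι) ℂ} (hX : IsSeparable X) :
    ∃ (J : Type) (_ : Fintype J) (M : Matrix κ J ℂ) (y : J → ι → ℂ),
      (∀ j, ∑ s, ‖y j s‖ ^ 2 ≤ 1) ∧ X = productColumns M y * (productColumns M y)ᴴ ∧
        partialTrace₂ X = M * Mᴴ := by
  obtain ⟨r, A, B, hA, hB, rfl⟩ := hX
  choose p u hu using fun j => Matrix.posSemidef_iff_eq_sum_vecMulVec.1 (hA j)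
  choose q v hv using fun j => Matrix.posSemidef_iff_eq_sum_vecMulVec.1 (hB j)
  choose x y hy hxy hprod using fun l : (Σ j, Fin (p j) × Fin (q j)) =>
    exists_normalized_product (u l.1 l.2.1) (v l.1 l.2.2)
  let M : Matrix κ (Σ j, Fin (p j) × Fin (q j)) ℂ := Matrix.of fun a l => x l a
  have hX : ∑ j, A j ⊗ₖ B j = productColumns M y * (productColumns M y)ᴴ := by
    ext ⟨a, s⟩ ⟨b, t⟩
    simp only [Matrix.sum_apply, Matrix.kronecker_apply, Matrix.mul_apply,
      Matrix.conjTranspose_apply, productColumns, Matrix.of_apply, M, hprod, Fintype.sum_sigma,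
      Fintype.sum_prod_type]
    refine Finset.sum_congr rfl fun j _ => ?_
    conv_lhs => rw [hu j, hv j]
    simp only [Matrix.sum_apply, Matrix.vecMulVec_apply, Finset.sum_mul_sum, Pi.star_apply,
      star_mul']
    exact Finset.sum_congr rfl fun _ _ => Finset.sum_congr rfl fun _ _ => by ring
  refine ⟨_, inferInstance, M, y, hy, hX, ?_⟩
  rw [hX]
  ext a b
  simp only [partialTrace₂, Matrix.of_apply, Matrix.mul_apply, Matrix.conjTranspose_apply,
    productColumns]
  rw [Finset.sum_comm]
  refine Finset.sum_congr rfl fun l _ => ?_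
  have h1 : M a l * ((∑ s, ‖y l s‖ ^ 2 : ℝ) : ℂ) = M a l := hxy l a
  calc ∑ s, M a l * y l s * star (M b l * y l s)
      = M a l * ((∑ s, ‖y l s‖ ^ 2 : ℝ) : ℂ) * star (M b l) := by
        push_cast
        rw [Finset.mul_sum, Finset.sum_mul]
        refine Finset.sum_congr rfl fun s _ => ?_
        rw [← Complex.mul_conj', star_mul', RCLike.star_def]
        ring
    _ = M a l * star (M b l) := by rw [h1]

theorem IsSeparable.posSemidef {κ ι : Type*} [Finite κ] [Fintype ι]
    {X : Matrix (κ × ι) (κ × ι) ℂ} (hX : IsSeparable X) : X.PosSemidef := by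
  obtain ⟨J, _, M, y, -, rfl, -⟩ := hX.exists_productColumns
  exact Matrix.posSemidef_self_mul_conjTranspose _

theorem IsSeparable.posSemidef_partialTrace₂ {κ ι : Type*} [Finite κ] [Fintype ι]
    {X : Matrix (κ × ι) (κ × ι) ℂ} (hX : IsSeparable X) : (partialTrace₂ X).PosSemidef := by
  obtain ⟨J, _, M, y, -, -, h⟩ := hX.exists_productColumns
  exact h ▸ Matrix.posSemidef_self_mul_conjTranspose _

theorem trace_partialTrace₂ {κ ι : Type*} [Fintype κ] [Fintype ι]
    (X : Matrix (κ × ι) (κ × ι) ℂ) : (partialTrace₂ X).trace = X.trace := by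
  simp [Matrix.trace, partialTrace₂, Fintype.sum_prod_type]

theorem IsSeparable.sum_map_eigenvalues_le {κ ι : Type*} [Fintype κ] [Fintype ι] [DecidableEq κ]
    [DecidableEq ι] {X : Matrix (κ × ι) (κ × ι) ℂ} (hX : IsSeparable X) {f : ℝ → ℝ}
    (hf : ConvexOn ℝ (Set.Ici 0) f) (hf0 : f 0 = 0) :
    ∑ k, f (hX.posSemidef.isHermitian.eigenvalues k) ≤
      ∑ i, f (hX.posSemidef_partialTrace₂.isHermitian.eigenvalues i) := by
  obtain ⟨J, _, M, y, hy, hXM, hRM⟩ := hX.exists_productColumns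
  obtain ⟨D, hD, hrow, hcol, hr⟩ := exists_doublySubstochastic M y hy hX.posSemidef.isHermitian
    hX.posSemidef_partialTrace₂.isHermitian hXM hRM
  refine sum_map_le_of_doublySubstochastic hf hf0 hD hrow hcol
    hX.posSemidef_partialTrace₂.eigenvalues_nonneg hr ?_
  rw [← trace_eq_re_sum_eigenvalues, ← trace_eq_re_sum_eigenvalues, trace_partialTrace₂]

theorem IsSeparable.schattenNorm_le {κ ι : Type*} [Fintype κ] [Fintype ι] [DecidableEq κ]
    [DecidableEq ι] {X : Matrix (κ × ι) (κ × ι) ℂ} (hX : IsSeparable X) {p : ℝ} (hp : 1 ≤ p) :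
    schattenNorm p X ≤ schattenNorm p (partialTrace₂ X) := by
  have hp0 : 0 < p := zero_lt_one.trans_le hp
  rw [schattenNorm, schattenNorm, trace_cfc_sqrt_rpow_re hX.posSemidef,
    trace_cfc_sqrt_rpow_re hX.posSemidef_partialTrace₂]
  exact Real.rpow_le_rpow
    (Finset.sum_nonneg fun k _ => Real.rpow_nonneg (hX.posSemidef.eigenvalues_nonneg k) _)
    (hX.sum_map_eigenvalues_le (convexOn_rpow hp) (Real.zero_rpow hp0.ne')) (by positivity)

theorem IsSeparable.entropy_partialTrace₂_le {κ ι : Type*} [Fintype κ] [Fintype ι] [DecidableEq κ]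
    [DecidableEq ι] {X : Matrix (κ × ι) (κ × ι) ℂ} (hX : IsSeparable X) :
    entropy (partialTrace₂ X) ≤ entropy X := by
  rw [entropy, entropy, trace_cfc_re hX.posSemidef.isHermitian,
    trace_cfc_re hX.posSemidef_partialTrace₂.isHermitian]
  have h := hX.sum_map_eigenvalues_le Real.convexOn_mul_log (by simp)
  simpa only [Real.negMulLog, neg_mul, Finset.sum_neg_distrib, neg_le_neg_iff] using h

/-! ### Entanglement breaking, trace preserving maps. -/

theorem IsSeparable.smul {κ ι : Type*} {X : Matrix (κ × ι) (κ × ι) ℂ} (hX : IsSeparable X)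
    {c : ℂ} (hc : 0 ≤ c) : IsSeparable (c • X) := by
  obtain ⟨r, A, B, hA, hB, rfl⟩ := hX
  refine ⟨r, fun j => c • A j, B, fun j => (hA j).smul hc, hB, ?_⟩
  simp only [Finset.smul_sum, Matrix.smul_kronecker]

theorem idTensor_smul {κ ι ι' : Type*} (Φ : Matrix ι ι ℂ →ₗ[ℂ] Matrix ι' ι' ℂ) (c : ℂ)
    (X : Matrix (κ × ι) (κ × ι) ℂ) : idTensor Φ (c • X) = c • idTensor Φ X := by
  ext a b
  have h : (Matrix.of fun s t => (c • X) (a.1, s) (b.1, t)) =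
    c • Matrix.of fun s t => X (a.1, s) (b.1, t) := rfl
  rw [idTensor, Matrix.of_apply, h, map_smul]
  rfl

/-- Rescaling by the trace reduces to density matrices; a positive semidefinite matrix of trace zero
vanishes. -/
theorem IsEntanglementBreaking.isSeparable {m n : ℕ}
    {Φ : Matrix (Fin m) (Fin m) ℂ →ₗ[ℂ] Matrix (Fin n) (Fin n) ℂ}
    (hΦ : IsEntanglementBreaking Φ) {k : ℕ} {Q : Matrix (Fin k × Fin m) (Fin k × Fin m) ℂ}
    (hQ : Q.PosSemidef) : IsSeparable (idTensor Φ Q) := by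
  rcases eq_or_ne Q.trace 0 with h | h
  · refine ⟨0, Fin.elim0, Fin.elim0, fun j => j.elim0, fun j => j.elim0, ?_⟩
    rw [hQ.trace_eq_zero_iff.1 h, ← zero_smul ℂ 0, idTensor_smul]
    simp
  · have h1 : IsSeparable (idTensor Φ (Q.trace⁻¹ • Q)) :=
      hΦ k _ ⟨hQ.smul (inv_nonneg.2 hQ.trace_nonneg), by simp [Matrix.trace_smul, h]⟩
    have h2 := h1.smul hQ.trace_nonneg
    rwa [← idTensor_smul, smul_inv_smul₀ h] at h2

theorem IsTracePreserving.partialTrace₂_idTensor {m n : ℕ} {κ : Type*}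
    {Φ : Matrix (Fin m) (Fin m) ℂ →ₗ[ℂ] Matrix (Fin n) (Fin n) ℂ} (hΦ : IsTracePreserving Φ)
    (Q : Matrix (κ × Fin m) (κ × Fin m) ℂ) :
    partialTrace₂ (idTensor Φ Q) = partialTrace₂ Q := by
  ext a b
  exact hΦ (Matrix.of fun s t => Q (a, s) (b, t))

theorem posSemidef_ketBra {ι : Type*} [Finite ι] (ψ : EuclideanSpace ℂ ι) :
    (ketBra ψ).PosSemidef :=
  Matrix.posSemidef_vecMulVec_self_star (R := ℂ) ψ.ofLp

end CBEntropy

theorem mainTheorem8 (m n : ℕ)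
    (Φ : Matrix (Fin m) (Fin m) ℂ →ₗ[ℂ] Matrix (Fin n) (Fin n) ℂ)
    (hEB : CBEntropy.IsEntanglementBreaking Φ) (hTP : CBEntropy.IsTracePreserving Φ) :
    (∀ p : ℝ, 1 ≤ p → BddAbove (CBEntropy.omegaRatios p Φ) ∧ CBEntropy.omega p Φ ≤ 1) ∧
    (BddBelow (CBEntropy.condEntropies Φ) ∧ 0 ≤ CBEntropy.cbMinEntropy Φ) ∧
    (∀ p : ℝ, 1 ≤ p → ∀ (k : ℕ) (Q : Matrix (Fin k × Fin m) (Fin k × Fin m) ℂ), Q.PosSemidef →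
      CBEntropy.schattenNorm p (CBEntropy.idTensor Φ Q) ≤
        CBEntropy.schattenNorm p (CBEntropy.partialTrace₂ Q)) := by
  have hnorm : ∀ p : ℝ, 1 ≤ p → ∀ (k : ℕ) (Q : Matrix (Fin k × Fin m) (Fin k × Fin m) ℂ),
      Q.PosSemidef → CBEntropy.schattenNorm p (CBEntropy.idTensor Φ Q) ≤
        CBEntropy.schattenNorm p (CBEntropy.partialTrace₂ Q) := fun p hp k Q hQ =>
    hTP.partialTrace₂_idTensor Q ▸ (hEB.isSeparable hQ).schattenNorm_le hp
  have hratio : ∀ p : ℝ, 1 ≤ p → ∀ x ∈ CBEntropy.omegaRatios p Φ, x ≤ 1 := by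
    rintro p hp x ⟨ψ, -, rfl⟩
    have hψ := CBEntropy.posSemidef_ketBra ψ
    refine div_le_one_of_le₀ (hnorm p hp m _ hψ) (CBEntropy.schattenNorm_nonneg ?_ p)
    exact hTP.partialTrace₂_idTensor (CBEntropy.ketBra ψ) ▸
      (hEB.isSeparable hψ).posSemidef_partialTrace₂
  have hentropy : ∀ x ∈ CBEntropy.condEntropies Φ, 0 ≤ x := by
    rintro x ⟨ψ, -, rfl⟩
    have h := (hEB.isSeparable (CBEntropy.posSemidef_ketBra ψ)).entropy_partialTrace₂_le
    rw [hTP.partialTrace₂_idTensor] at h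
    exact sub_nonneg.2 h
  -- For `m = 0` there are no unit vectors; `sSup ∅ = sInf ∅ = 0` still satisfies both bounds.
  exact ⟨fun p hp => ⟨⟨1, hratio p hp⟩, Real.sSup_le (hratio p hp) zero_le_one⟩,
    ⟨⟨0, hentropy⟩, Real.sInf_nonneg hentropy⟩, hnorm⟩
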